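/- Let $H$ be a Heyting algebra and let $M$ be a Heyting module over $H$. That is, $M$ is a join semilattice with least element $0$, equipped with an action $H\times M\to M$, $(x,m)\mapsto x\wedge m$, that is order preserving in both variables and satisfies $1\wedge m=m$, $0\wedge m=0$, $(x\wedge y)\wedge m=x\wedge(y\wedge m)$, $(x\vee y)\wedge m=(x\wedge m)\vee(y\wedge m)$ and $x\wedge(m\vee n)=(x\wedge m)\vee(x\wedge n)$, such that for each $m\in M$ the map $H\to M$, $x\mapsto x\wedge m$, has a right adjoint. A Heyting submodule of $M$ is a subset that is closed under finite joins (so it contains $0$) and under the action of $H$. Let $Sub(M)$ be the set of Heyting submodules of $M$, with the topology that has as a subbasis of open sets the sets $$D(m_1,\ldots,m_n)=\{N\in Sub(M) : \{m_1,\ldots,m_n\}\not\subseteq N\},\qquad m_1,\ldots,m_n\in M.$$ A closure operator on $Sub(M)$ is a map $\mathbf c:Sub(M)\to Sub(M)$ that is extensive, order preserving (for inclusion) and idempotent. It is of finite type if $\mathbf c(N)=\bigcup_{N'}\mathbf c(N')$ for every $N\in Sub(M)$, where $N'$ runs over the finitely generated Heyting submodules of $N$, i.e. those that are the smallest Heyting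 submodule containing some finite subset of $M$. A topological space is spectral if it is quasi-compact, its quasi-compact open subsets are closed under finite intersections and form a basis, and every non-empty irreducible closed subset has a unique generic point. (1) Let $\mathbf c$ be a closure operator of finite type on $Sub(M)$. Then $Sub^{\mathbf c}(M)=\{N\in Sub(M):\mathbf c(N)=N\}$, with the subspace topology, is a spectral space, and the sets $D(m_1,\ldots,m_n)\cap Sub^{\mathbf c}(M)$ form a subbasis of its topology that consists of quasi-compact open sets. (2) The set of hereditary submodules of $M$, i.e. of those subsets of $M$ that are closed under finite joins and downward closed (every such subset is a Heyting submodule), with the subspace topology induced by $Sub(M)$, is a spectral space. -/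

import Mathlib

/-- A distributive module over a (bounded) distributive lattice `L`: a join semilattice `M` with
least element, with an order preserving action of `L`, written `x • m` (in the literature `x ∧ m`),
that is compatible with finite joins in both variables. -/
class DistributiveModule (L M : Type*) [DistribLattice L] [BoundedOrder L]
    [SemilatticeSup M] [OrderBot M] extends SMul L M where
  smul_le_smul' : ∀ {x y : L} {m n : M}, x ≤ y → m ≤ n → x • m ≤ y • n
  top_smul' : ∀ m : M, (⊤ : L) • m = m
  bot_smul' : ∀ m : M, (⊥ : L) • m = ⊥
  inf_smul' : ∀ (x y : L) (m : M), (x ⊓ y) • m = x • (y • m)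
  sup_smul' : ∀ (x y : L) (m : M), (x ⊔ y) • m = x • m ⊔ y • m
  smul_sup' : ∀ (x : L) (m n : M), x • (m ⊔ n) = x • m ⊔ x • n

/-- A Heyting module over a Heyting algebra `H`: a distributive module `M` such that, for every
`m`, the map `x ↦ x • m` from `H` to `M` has a right adjoint. -/
class HeytingModule (H M : Type*) [HeytingAlgebra H] [SemilatticeSup M] [OrderBot M] extends
    DistributiveModule H M where
  exists_rightAdjoint' : ∀ m : M, ∃ r : M → H, GaloisConnection (fun x : H => x • m) r

/-- A Heyting submodule of `M`: a subset closed under finite joins (including the empty join `⊥`)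
and under the action of `H`. -/
structure HeytingSubmodule (H M : Type*) [HeytingAlgebra H] [SemilatticeSup M] [OrderBot M]
    [HeytingModule H M] where
  carrier : Set M
  bot_mem' : ⊥ ∈ carrier
  sup_mem' : ∀ {m n : M}, m ∈ carrier → n ∈ carrier → m ⊔ n ∈ carrier
  smul_mem' : ∀ (x : H) {m : M}, m ∈ carrier → x • m ∈ carrier

namespace HeytingSubmodule

instance (H M : Type*) [HeytingAlgebra H] [SemilatticeSup M] [OrderBot M]
    [HeytingModule H M] : SetLike (HeytingSubmodule H M) M where
  coe := carrier
  coe_injective := by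
    rintro ⟨_, _, _, _⟩ ⟨_, _, _, _⟩ h
    cases h
    rfl

/-- Heyting submodules are ordered by inclusion. -/
instance (H M : Type*) [HeytingAlgebra H] [SemilatticeSup M] [OrderBot M]
    [HeytingModule H M] : PartialOrder (HeytingSubmodule H M) :=
  .ofSetLike (HeytingSubmodule H M) M

/-- `V H s` is the set of Heyting submodules containing the finite set `s` of elements. -/
def V (H : Type*) {M : Type*} [HeytingAlgebra H] [SemilatticeSup M] [OrderBot M]
    [HeytingModule H M] (s : Finset M) : Set (HeytingSubmodule H M) :=
  {N | ∀ m ∈ s, m ∈ N}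

/-- `D H s` is the complement of `V H s`. -/
def D (H : Type*) {M : Type*} [HeytingAlgebra H] [SemilatticeSup M] [OrderBot M]
    [HeytingModule H M] (s : Finset M) : Set (HeytingSubmodule H M) :=
  (V H s)ᶜ

/-- The topology on `Sub(M)` with the sets `D H s` as a subbasis of open sets. -/
instance (H M : Type*) [HeytingAlgebra H] [SemilatticeSup M] [OrderBot M]
    [HeytingModule H M] : TopologicalSpace (HeytingSubmodule H M) :=
  TopologicalSpace.generateFrom (Set.range (D H))

/-- `N` is finitely generated: it is the smallest Heyting submodule containing some finite set. -/
def IsFG {H M : Type*} [HeytingAlgebra H] [SemilatticeSup M] [OrderBot M]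
    [HeytingModule H M] (N : HeytingSubmodule H M) : Prop :=
  ∃ s : Finset M, IsLeast (V H s) N

/-- A closure operator on `Sub(M)` is of finite type if, for every `N`, the set `c N` is the union
of the sets `c N'` over the finitely generated submodules `N'` of `N`. -/
def IsFiniteType {H M : Type*} [HeytingAlgebra H] [SemilatticeSup M] [OrderBot M]
    [HeytingModule H M] (c : ClosureOperator (HeytingSubmodule H M)) : Prop :=
  ∀ N : HeytingSubmodule H M,
    (c N : Set M) = ⋃ N' ∈ {N' : HeytingSubmodule H M | N' ≤ N ∧ N'.IsFG}, (c N' : Set M)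

/-- The set of Heyting submodules of `M` fixed by `c`. -/
def fixedBy {H M : Type*} [HeytingAlgebra H] [SemilatticeSup M] [OrderBot M]
    [HeytingModule H M] (c : ClosureOperator (HeytingSubmodule H M)) :
    Set (HeytingSubmodule H M) :=
  {N | c N = N}

end HeytingSubmodule

/-- A hereditary submodule of `M`: a subset that is closed under finite joins (including the empty
join `⊥`) and downward closed. -/
structure IsHereditarySubmodule {M : Type*} [SemilatticeSup M] [OrderBot M] (A : Set M) :
    Prop where
  bot_mem : ⊥ ∈ A
  sup_mem : ∀ {m n : M}, m ∈ A → n ∈ A → m ⊔ n ∈ A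
  mem_of_le : ∀ {m n : M}, n ∈ A → m ≤ n → m ∈ A

/-- Every hereditary submodule is automatically a Heyting submodule. -/
theorem IsHereditarySubmodule.exists_coe_eq (H : Type*) {M : Type*} [HeytingAlgebra H]
    [SemilatticeSup M] [OrderBot M] [HeytingModule H M] {A : Set M}
    (hA : IsHereditarySubmodule A) : ∃ N : HeytingSubmodule H M, (N : Set M) = A :=
  ⟨{ carrier := A
     bot_mem' := hA.bot_mem
     sup_mem' := hA.sup_mem
     smul_mem' := fun x m hm => hA.mem_of_le hm
      ((DistributiveModule.smul_le_smul' (le_top : x ≤ ⊤) le_rfl).trans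
        (DistributiveModule.top_smul' m).le) }, rfl⟩

/-- The set of hereditary submodules of `M`, as a subset of `Sub(M)`. -/
def hereditarySubmodules (H M : Type*) [HeytingAlgebra H] [SemilatticeSup M] [OrderBot M]
    [HeytingModule H M] : Set (HeytingSubmodule H M) :=
  {N | IsHereditarySubmodule (N : Set M)}

/-! A T0 space is spectral once every ultrafilter `F` has a patch limit for a subbasis `b`: a point
lying in exactly those `b i` that belong to `F` (`HasPatchLimits.spectralSpace`). In `Sub(M)` the
patch limit of `F` consists of the elements lying in `F`-almost all submodules. It is therefore
enough that each of the two subsets is stable under these limits. For hereditary submodules this is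
checked elementwise; for a finite type `c`, membership in `c N` depends on finitely many elements of
`N`, and finite conditions pass to `F`-almost all submodules. -/

open Set Filter Topology TopologicalSpace

section Subbasis

variable {X ι : Type*} [TopologicalSpace X] {b : ι → Set X}

/-- `b` satisfies the ultrafilter criterion: every ultrafilter on `X` has a limit for the patch
topology generated by the sets `b i` and their complements. -/
def HasPatchLimits (b : ι → Set X) : Prop :=
  ∀ F : Ultrafilter X, ∃ x, ∀ i, x ∈ b i ↔ b i ∈ F

theorem HasPatchLimits.le_nhds (hT : ‹TopologicalSpace X› = generateFrom (range b))
    {F : Ultrafilter X} {x : X} (hx : ∀ i, x ∈ b i ↔ b i ∈ F) : (F : Filter X) ≤ 𝓝 x := by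
  rw [hT, nhds_generateFrom]
  refine le_iInf₂ fun s hs => ?_
  obtain ⟨hxs, i, rfl⟩ := hs
  exact le_principal_iff.2 ((hx i).1 hxs)

/-- An ultrafilter containing the intersection contains every member of `f`, so its patch limit lies
in every member. The family may be infinite; the empty one gives compactness of `X`. -/
theorem HasPatchLimits.isCompact_sInter (hb : HasPatchLimits b)
    (hT : ‹TopologicalSpace X› = generateFrom (range b)) {f : Set (Set X)}
    (hf : f ⊆ range b) : IsCompact (⋂₀ f) := by
  rw [isCompact_iff_ultrafilter_le_nhds]
  intro F hF
  obtain ⟨x, hx⟩ := hb F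
  refine ⟨x, fun s hs => ?_, le_nhds hT hx⟩
  obtain ⟨i, rfl⟩ := hf hs
  exact (hx i).2 (mem_of_superset (le_principal_iff.1 hF) (sInter_subset_of_mem hs))

theorem HasPatchLimits.isCompact (hb : HasPatchLimits b)
    (hT : ‹TopologicalSpace X› = generateFrom (range b)) (i : ι) : IsCompact (b i) := by
  simpa using hb.isCompact_sInter hT (f := {b i}) (by simp)

theorem HasPatchLimits.quasiSober (hb : HasPatchLimits b)
    (hT : ‹TopologicalSpace X› = generateFrom (range b)) : QuasiSober X where
  sober {S} hS hSc := by
    -- Irreducibility of `S` is what makes the nonempty traces on `S` of open sets a filter base.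
    -- The generic point is a patch limit of an ultrafilter finer than `G`.
    let G : Filter X :=
      { sets := {A | ∃ U, IsOpen U ∧ (S ∩ U).Nonempty ∧ S ∩ U ⊆ A}
        univ_sets := ⟨univ, isOpen_univ, by simpa using hS.1, subset_univ _⟩
        sets_of_superset := fun ⟨U, hU, hne, hA⟩ hAB => ⟨U, hU, hne, hA.trans hAB⟩
        inter_sets := fun ⟨U, hU, hne, hA⟩ ⟨V, hV, hne', hB⟩ =>
          ⟨U ∩ V, hU.inter hV, hS.2 U V hU hV hne hne', fun _ hx =>
            ⟨hA ⟨hx.1, hx.2.1⟩, hB ⟨hx.1, hx.2.2⟩⟩⟩ }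
    have hG : G.NeBot := by
      refine neBot_iff.2 fun h => ?_
      obtain ⟨U, -, hne, hA⟩ : ∅ ∈ G := h ▸ mem_bot
      exact hne.ne_empty (subset_empty_iff.1 hA)
    obtain ⟨x, hx⟩ := hb (Ultrafilter.of G)
    have hle : (Ultrafilter.of G : Filter X) ≤ G := Ultrafilter.of_le G
    have hSG : S ∈ G := ⟨univ, isOpen_univ, by simpa using hS.1, inter_subset_left⟩
    have hxS : x ∈ S := isClosed_iff_ultrafilter.1 hSc x _ (le_nhds hT hx) (hle hSG)
    refine ⟨x, isGenericPoint_iff_specializes.2 fun y => ⟨fun h => h.mem_closed hSc hxS, fun hy => ?_⟩⟩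
    rw [Specializes, hT, nhds_generateFrom (a := y), ← hT]
    refine le_iInf₂ fun s hs => le_principal_iff.2 ?_
    obtain ⟨hys, i, rfl⟩ := hs
    have hbi : IsOpen (b i) := hT ▸ isOpen_generateFrom_of_mem (mem_range_self i)
    -- `b i` meets `S` at `y`, so it belongs to `G`, and hence contains the patch limit `x`.
    exact hbi.mem_nhds ((hx i).2 (hle ⟨b i, hbi, ⟨y, hy, hys⟩, inter_subset_right⟩))

theorem HasPatchLimits.spectralSpace [T0Space X] (hb : HasPatchLimits b)
    (hT : ‹TopologicalSpace X› = generateFrom (range b)) : SpectralSpace X := by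
  have basis := isTopologicalBasis_of_subbasis hT
  have : CompactSpace X := ⟨by simpa using hb.isCompact_sInter hT (empty_subset _)⟩
  have : QuasiSober X := hb.quasiSober hT
  have : PrespectralSpace X := .of_isTopologicalBasis basis <| by
    rintro _ ⟨f, ⟨-, hf⟩, rfl⟩
    exact hb.isCompact_sInter hT hf
  have : QuasiSeparatedSpace X := by
    -- The basis of finite intersections is indexed by itself; the intersection of two members is
    -- again an intersection of subbasic sets, hence compact.
    refine .of_isTopologicalBasis
      (b := ((↑) : ((fun f => ⋂₀ f) '' {f : Set (Set X) | f.Finite ∧ f ⊆ range b}) → Set X))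
      (by rwa [Subtype.range_coe]) ?_
    rintro ⟨_, f, ⟨-, hf⟩, rfl⟩ ⟨_, g, ⟨-, hg⟩, rfl⟩
    simp only [← sInter_union]
    exact hb.isCompact_sInter hT (union_subset hf hg)
  constructor

end Subbasis

namespace HeytingSubmodule

variable {H M : Type*} [HeytingAlgebra H] [SemilatticeSup M] [OrderBot M] [HeytingModule H M]

/-- The limit of an ultrafilter of Heyting submodules: the elements that belong to almost all
submodules. -/
def ultrafilterLimit (F : Ultrafilter (HeytingSubmodule H M)) : HeytingSubmodule H M where
  carrier := {m | ∀ᶠ N in (F : Filter (HeytingSubmodule H M)), m ∈ N}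
  bot_mem' := Eventually.of_forall fun N => N.bot_mem'
  sup_mem' hm hn := by
    filter_upwards [hm, hn] with N h h' using N.sup_mem' h h'
  smul_mem' x m hm := by
    filter_upwards [hm] with N h using N.smul_mem' x h

theorem mem_ultrafilterLimit {F : Ultrafilter (HeytingSubmodule H M)} {m : M} :
    m ∈ ultrafilterLimit F ↔ ∀ᶠ N in (F : Filter (HeytingSubmodule H M)), m ∈ N :=
  Iff.rfl

theorem ultrafilterLimit_mem_V_iff {F : Ultrafilter (HeytingSubmodule H M)} {s : Finset M} :
    ultrafilterLimit F ∈ V H s ↔ V H s ∈ F :=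
  (eventually_all_finset (l := (F : Filter (HeytingSubmodule H M))) s
    (p := fun m N => m ∈ N)).symm

theorem ultrafilterLimit_mem_D_iff {F : Ultrafilter (HeytingSubmodule H M)} {s : Finset M} :
    ultrafilterLimit F ∈ D H s ↔ D H s ∈ F := by
  rw [D, Ultrafilter.compl_mem_iff_notMem, mem_compl_iff, ultrafilterLimit_mem_V_iff]

theorem isOpen_D (s : Finset M) : IsOpen (D H s) :=
  isOpen_generateFrom_of_mem (mem_range_self s)

instance : T0Space (HeytingSubmodule H M) where
  t0 N N' h := SetLike.ext fun m => by
    simpa [D, V] using not_congr (h.mem_open_iff (isOpen_D (H := H) {m}))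

theorem subtype_topology_eq (Z : Set (HeytingSubmodule H M)) :
    (instTopologicalSpaceSubtype : TopologicalSpace Z) =
      generateFrom (range fun s : Finset M => (Subtype.val ⁻¹' D H s : Set Z)) := by
  change induced _ (generateFrom _) = _
  rw [induced_generateFrom_eq, ← range_comp]
  rfl

/-- An ultrafilter on `Z` is pushed forward to `Sub(M)`; by `hZ` the limit taken there lies in `Z`.
-/
theorem hasPatchLimits_of_ultrafilterLimit_mem {Z : Set (HeytingSubmodule H M)}
    (hZ : ∀ F : Ultrafilter (HeytingSubmodule H M), Z ∈ F → ultrafilterLimit F ∈ Z) :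
    HasPatchLimits fun s : Finset M => (Subtype.val ⁻¹' D H s : Set Z) := by
  intro F
  have hF : Z ∈ F.map Subtype.val :=
    Ultrafilter.mem_map.2 (univ_mem' fun x => x.2)
  exact ⟨⟨_, hZ _ hF⟩, fun s => ultrafilterLimit_mem_D_iff⟩

theorem ultrafilterLimit_mem_fixedBy {c : ClosureOperator (HeytingSubmodule H M)}
    (hc : IsFiniteType c) {F : Ultrafilter (HeytingSubmodule H M)} (hF : fixedBy c ∈ F) :
    ultrafilterLimit F ∈ fixedBy c := by
  refine le_antisymm (fun m hm => ?_) (c.le_closure _)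
  have hm' : m ∈ (c (ultrafilterLimit F) : Set M) := hm
  rw [hc] at hm'
  obtain ⟨N', ⟨hle, s, hs, hleast⟩, hmN'⟩ := mem_iUnion₂.1 hm'
  -- The finite generating set `s` of `N'` lies in the limit, hence in almost every `N`. For such
  -- `N` fixed by `c`, leastness gives `N' ≤ N`, so `m ∈ c N' ≤ c N = N`.
  have hsF : V H s ∈ F := ultrafilterLimit_mem_V_iff.1 fun x hx => hle (hs x hx)
  rw [mem_ultrafilterLimit]
  filter_upwards [hF, hsF] with N hN hsN
  have h : c N' ≤ c N := c.monotone (hleast hsN)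
  rw [show c N = N from hN] at h
  exact h hmN'

theorem ultrafilterLimit_mem_hereditarySubmodules {F : Ultrafilter (HeytingSubmodule H M)}
    (hF : hereditarySubmodules H M ∈ F) : ultrafilterLimit F ∈ hereditarySubmodules H M where
  bot_mem := (ultrafilterLimit F).bot_mem'
  sup_mem := (ultrafilterLimit F).sup_mem'
  mem_of_le {m n} hn hmn := by
    have hn' : ∀ᶠ N in (F : Filter (HeytingSubmodule H M)), n ∈ N := hn
    change ∀ᶠ N in (F : Filter (HeytingSubmodule H M)), m ∈ N
    filter_upwards [hF, hn'] with N hN h using hN.mem_of_le h hmn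

end HeytingSubmodule

theorem mainTheorem4 {H M : Type*} [HeytingAlgebra H] [SemilatticeSup M] [OrderBot M]
    [HeytingModule H M] :
    (∀ c : ClosureOperator (HeytingSubmodule H M), HeytingSubmodule.IsFiniteType c →
      SpectralSpace (HeytingSubmodule.fixedBy c) ∧
      (instTopologicalSpaceSubtype : TopologicalSpace (HeytingSubmodule.fixedBy c)) =
        TopologicalSpace.generateFrom
          (Set.range fun s : Finset M =>
            (Subtype.val ⁻¹' HeytingSubmodule.D H s : Set (HeytingSubmodule.fixedBy c))) ∧
      ∀ s : Finset M,
        IsOpen (Subtype.val ⁻¹' HeytingSubmodule.D H s : Set (HeytingSubmodule.fixedBy c)) ∧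
        IsCompact (Subtype.val ⁻¹' HeytingSubmodule.D H s : Set (HeytingSubmodule.fixedBy c))) ∧
    SpectralSpace (hereditarySubmodules H M) := by
  refine ⟨fun c hc => ?_, ?_⟩
  · have hb := HeytingSubmodule.hasPatchLimits_of_ultrafilterLimit_mem
      fun F => HeytingSubmodule.ultrafilterLimit_mem_fixedBy hc (F := F)
    have hT := HeytingSubmodule.subtype_topology_eq (HeytingSubmodule.fixedBy c)
    exact ⟨hb.spectralSpace hT, hT, fun s =>
      ⟨(HeytingSubmodule.isOpen_D s).preimage continuous_subtype_val, hb.isCompact hT s⟩⟩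
  · exact (HeytingSubmodule.hasPatchLimits_of_ultrafilterLimit_mem
      fun F => HeytingSubmodule.ultrafilterLimit_mem_hereditarySubmodules (F := F)).spectralSpace
        (HeytingSubmodule.subtype_topology_eq _)
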